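/- All graphs are finite and simple. For a graph $L$ and an integer $t\ge 1$, let $tL$ denote the disjoint union of $t$ copies of $L$. A graph $G$ has constant link $L$ if for every vertex $v$ of $G$ the subgraph of $G$ induced by the open neighborhood of $v$ is isomorphic to $L$. The circumference of a graph is the length of a longest cycle in it, and it is $0$ if the graph has no cycle. Let $t,k,g$ be integers with $t,k\ge 2$ and $g\ge\max\{4,k+1\}$, and let $F$ be a connected graph of order $k$ with constant link $L$ and circumference $c$. Then there is a positive integer $n$ such that, for every integer $q\ge 1$, there is a connected graph of order $qn$ with constant link $tL$ and with no cycle of length $\ell$ for any integer $\ell$ with $c<\ell<g$. -/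

import Mathlib

namespace ConstantLink

/-- `HasConstantLink G L`: for every vertex `v` of `G`, the subgraph of `G` induced by the open
neighborhood of `v` is isomorphic to `L`. -/
def HasConstantLink {V W : Type*} (G : SimpleGraph V) (L : SimpleGraph W) : Prop :=
  ∀ v : V, Nonempty (G.induce (G.neighborSet v) ≃g L)

/-- `copies t L` is the graph `tL`, the disjoint union of `t` copies of `L`. -/
def copies {W : Type*} (t : ℕ) (L : SimpleGraph W) : SimpleGraph (Fin t × W) where
  Adj x y := x.1 = y.1 ∧ L.Adj x.2 y.2
  symm := ⟨fun _ _ h => ⟨h.1.symm, h.2.symm⟩⟩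
  loopless := ⟨fun _ h => h.2.ne rfl⟩

/-- `HasCycleOfLength G l`: the graph `G` contains a cycle of length `l`. -/
def HasCycleOfLength {V : Type*} (G : SimpleGraph V) (l : ℕ) : Prop :=
  ∃ (u : V) (p : G.Walk u u), p.IsCycle ∧ p.length = l

/-- The circumference of a finite graph, the length of a longest cycle. It is `0` for a graph
without cycles. -/
noncomputable def circumference {V : Type*} [Finite V] (G : SimpleGraph V) : ℕ :=
  sSup {l : ℕ | HasCycleOfLength G l}

end ConstantLink

/-! Take a finite system of points and blocks with `t` blocks through each point, blocks labelled by
`V`, and no closed chain of fewer than `g` blocks, and put a copy of `F` on every block. As `g > 3`,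
the blocks through a point meet only there and no edge joins two of them elsewhere, so the link is
`tL`. A cycle shorter than `g` cannot pass through several blocks, so it is a cycle of `F` and has
length at most `c`.

Such a system exists because the free product of cyclic groups of orders `|V|` and `t` has finite
quotients in which no short reduced word dies (`exists_perm_representation`); blocks and points are
the cosets of the two factors. All multiples `qn` of its number of points `n` come from cyclic
covers that shift the sheet at one non-bridge flag: they keep the girth condition and stay
connected. -/

namespace ConstantLink

open SimpleGraph

variable {B V P W : Type*}

/-- `FlagChain pt e p m`: there is a chain of `m` blocks, given by flags `e = e₁, e₁', …, eₘ, eₘ'`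
where `eᵢ ≠ eᵢ'` lie in the same block, `eᵢ' ≠ eᵢ₊₁` lie over the same point, and `eₘ'` lies
over `p`. Here a flag is a pair of a block and a label, and `pt` maps a flag to its point. -/
inductive FlagChain (pt : B × V → P) : B × V → P → ℕ → Prop
  | single {e e' : B × V} (hb : e.1 = e'.1) (hne : e ≠ e') : FlagChain pt e (pt e') 1
  | cons {e e' f : B × V} {p : P} {m : ℕ} (hb : e.1 = e'.1) (hne : e ≠ e')
      (hp : pt e' = pt f) (hf : e' ≠ f) (h : FlagChain pt f p m) : FlagChain pt e p (m + 1)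

/-- No chain of fewer than `g` blocks closes up. -/
def GirthGE (pt : B × V → P) (g : ℕ) : Prop :=
  ∀ e p m, FlagChain pt e p m → m < g → pt e ≠ p

/-- The points are connected to each other through blocks without use of the flags in `A`. -/
def LinkedAvoiding (pt : B × V → P) (A : Set (B × V)) : Prop :=
  ∀ f : P → Prop, (∀ e e', e ∉ A → e' ∉ A → e.1 = e'.1 → (f (pt e) ↔ f (pt e'))) →
    ∀ p p', f p ↔ f p'

/-- The graph in which each block carries a copy of `F`. -/
def blockGraph (F : SimpleGraph V) (pt : B × V → P) : SimpleGraph P where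
  Adj p p' := p ≠ p' ∧ ∃ b v v', F.Adj v v' ∧ pt (b, v) = p ∧ pt (b, v') = p'
  symm := ⟨fun _ _ ⟨hne, b, v, v', h, h1, h2⟩ => ⟨hne.symm, b, v', v, h.symm, h2, h1⟩⟩
  loopless := ⟨fun _ h => h.1 rfl⟩

/-! ### Large girth: links and short cycles of the block graph -/

section

variable {pt : B × V → P} {g : ℕ} {F : SimpleGraph V} {L : SimpleGraph W}

theorem GirthGE.injective (hg : GirthGE pt g) (h : 1 < g) (b : B) {v v' : V}
    (hv : pt (b, v) = pt (b, v')) : v = v' := by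
  by_contra hne
  exact hg (b, v) _ 1 (.single (e' := (b, v')) rfl (by simpa using hne)) h hv

theorem GirthGE.eq_block (hg : GirthGE pt g) (h : 2 < g) {b b' : B} {v w v' w' : V}
    (hv : pt (b, v) = pt (b', v')) (hw : pt (b, w) = pt (b', w')) (hne : pt (b, v) ≠ pt (b, w)) :
    b = b' := by
  by_contra hb
  refine hg (b, v) _ 2 (.cons (e' := (b, w)) (f := (b', w')) rfl ?_ hw ?_
    (.single (e' := (b', v')) rfl ?_)) h hv
  · rintro h; exact hne (congrArg pt h)
  · simp [hb]
  · rintro h; exact hne (hv.trans ((congrArg pt h).symm.trans hw.symm))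

theorem GirthGE.blockGraph_adj_iff (hg : GirthGE pt g) (h : 2 < g) (b : B) (v v' : V) :
    (blockGraph F pt).Adj (pt (b, v)) (pt (b, v')) ↔ F.Adj v v' := by
  constructor
  · rintro ⟨hne, b', w, w', hw, h1, h2⟩
    obtain rfl := hg.eq_block h h1.symm h2.symm hne
    rwa [hg.injective (by omega) b h1, hg.injective (by omega) b h2] at hw
  · intro hv
    exact ⟨fun he => hv.ne (hg.injective (by omega) b he), b, v, v', hv, rfl, rfl⟩

/-- Otherwise `b`, `b''`, `b'` close up to a chain of three blocks, or, if `b''` is one of the other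
two, `b` and `b'` share two points. This keeps the `t` copies of `L` in a link disconnected from
each other. -/
theorem GirthGE.no_triangle (hg : GirthGE pt g) (h : 3 < g) {b b' b'' : B} {v x v' x' y y' : V}
    (hp : pt (b, v) = pt (b', v')) (hvx : v ≠ x) (hvx' : v' ≠ x')
    (h1 : pt (b'', y) = pt (b, x)) (h2 : pt (b'', y') = pt (b', x'))
    (hne : pt (b, x) ≠ pt (b', x')) : b = b' := by
  by_contra hb
  have inj := fun b {v v'} => hg.injective (by omega : 1 < g) b (v := v) (v' := v')
  by_cases hb1 : b'' = b
  · subst hb1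
    obtain rfl := inj _ h1
    refine hb (hg.eq_block (by omega) hp h2 fun he => ?_)
    exact hvx' (inj _ (hp.symm.trans (he.trans h2)))
  by_cases hb2 : b'' = b'
  · subst hb2
    obtain rfl := inj _ h2
    refine hb (hg.eq_block (by omega) hp h1.symm fun he => ?_)
    exact hvx (inj _ he)
  refine hg (b, v) _ 3 (.cons (e' := (b, x)) (f := (b'', y)) rfl (by simpa using hvx) h1.symm
    (by simp [Ne.symm hb1]) (.cons (e' := (b'', y')) (f := (b', x')) rfl ?_ h2 (by simp [hb2])
    (.single (e' := (b', v')) rfl (by simpa using hvx'.symm)))) h hp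
  rintro he
  exact hne (h1.symm.trans ((congrArg pt he).trans h2))

theorem GirthGE.hasConstantLink {t : ℕ} (hg : GirthGE pt g) (h : 3 < g)
    (hfib : ∀ p, Nonempty (Fin t ≃ {e // pt e = p})) (hL : HasConstantLink F L) :
    HasConstantLink (blockGraph F pt) (copies t L) := by
  intro p
  obtain ⟨σ⟩ := hfib p
  have iso : ∀ v, L ≃g F.induce (F.neighborSet v) := fun v => (hL v).some.symm
  have inj := fun b {v v'} => hg.injective (by omega : 1 < g) b (v := v) (v' := v')
  -- `σ i` is the `i`-th flag over `p`; its block contributes the `i`-th copy of `L`.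
  let nb : Fin t × W → V := fun x => (iso (σ x.1).1.2 x.2).1
  have hnb : ∀ x, F.Adj (σ x.1).1.2 (nb x) := fun x => (iso (σ x.1).1.2 x.2).2
  let u : Fin t × W → P := fun x => pt ((σ x.1).1.1, nb x)
  have hσ : ∀ i, pt ((σ i).1.1, (σ i).1.2) = p := fun i => (σ i).2
  have hu : ∀ x, u x ∈ (blockGraph F pt).neighborSet p := by
    intro x
    have := (hg.blockGraph_adj_iff (F := F) (by omega) (σ x.1).1.1 (σ x.1).1.2 (nb x)).2 (hnb x)
    rwa [hσ] at this
  have hblock : ∀ i j, (σ i).1.1 = (σ j).1.1 → i = j := by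
    intro i j hij
    apply σ.injective
    apply Subtype.ext
    refine Prod.ext hij (inj (σ j).1.1 ?_)
    rw [hσ j, ← hij]
    exact hσ i
  have hu_inj : ∀ x y, u x = u y → x = y := by
    intro x y hxy
    have hb : (σ x.1).1.1 = (σ y.1).1.1 :=
      hg.eq_block (by omega) ((hσ _).trans (hσ _).symm) hxy (by rw [hσ]; exact (mem_neighborSet _ _ _).1 (hu x) |>.ne)
    have h1 := hblock _ _ hb
    obtain ⟨i, w⟩ := x
    obtain ⟨j, w'⟩ := y
    obtain rfl : i = j := h1
    have h2 := inj _ hxy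
    exact congrArg (Prod.mk i) ((iso _).injective (Subtype.ext h2))
  have hu_surj : ∀ p' ∈ (blockGraph F pt).neighborSet p, ∃ x, u x = p' := by
    rintro p' ⟨hne, b, v, v', hv, h1, rfl⟩
    have h2 : (σ (σ.symm ⟨(b, v), h1⟩)).1 = (b, v) := by simp
    generalize σ.symm ⟨(b, v), h1⟩ = i at h2
    have h3 : F.Adj (σ i).1.2 v' := by rw [h2]; exact hv
    refine ⟨(i, (iso _).symm ⟨v', h3⟩), ?_⟩
    simp only [u, nb, RelIso.apply_symm_apply]
    rw [h2]
  have hadj : ∀ x y, (blockGraph F pt).Adj (u x) (u y) ↔ (copies t L).Adj x y := by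
    intro x y
    have key : ∀ (i : Fin t) (w w' : W), (blockGraph F pt).Adj (u (i, w)) (u (i, w')) ↔
        L.Adj w w' := by
      intro i w w'
      rw [hg.blockGraph_adj_iff (by omega)]
      exact (iso (σ i).1.2).map_rel_iff
    constructor
    · intro hxy
      have h1 : x.1 = y.1 := by
        obtain ⟨hne, b, v, v', -, h1, h2⟩ := hxy
        exact hblock _ _ (hg.no_triangle h ((hσ _).trans (hσ _).symm) (hnb x).ne (hnb y).ne
          h1 h2 hne)
      obtain ⟨i, w⟩ := x
      obtain ⟨j, w'⟩ := y
      obtain rfl : i = j := h1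
      exact ⟨rfl, (key i w w').1 hxy⟩
    · obtain ⟨i, w⟩ := x
      obtain ⟨j, w'⟩ := y
      rintro ⟨h1, h2⟩
      obtain rfl : i = j := h1
      exact (key i w w').2 h2
  refine ⟨RelIso.symm ⟨Equiv.ofBijective (fun x => ⟨u x, hu x⟩) ⟨?_, ?_⟩, ?_⟩⟩
  · intro x y hxy
    exact hu_inj x y (congrArg Subtype.val hxy)
  · rintro ⟨p', hp'⟩
    obtain ⟨x, rfl⟩ := hu_surj p' hp'
    exact ⟨x, rfl⟩
  · intro x y
    exact hadj x y

theorem LinkedAvoiding.blockGraph_connected [Nonempty P] (hl : LinkedAvoiding pt ∅)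
    (hF : F.Connected) (hg : GirthGE pt g) (h : 2 < g) : (blockGraph F pt).Connected := by
  have p0 : P := Classical.arbitrary P
  refine (connected_iff_exists_forall_reachable _).2 ⟨p0, fun p => ?_⟩
  refine (hl (fun p => (blockGraph F pt).Reachable p0 p) ?_ p0 p).1 (Reachable.refl _)
  rintro ⟨b, v⟩ ⟨b', v'⟩ - - hb
  obtain rfl : b = b' := hb
  let φ : F →g blockGraph F pt :=
    ⟨fun v => pt (b, v), fun {v v'} hv => (hg.blockGraph_adj_iff h b v v').2 hv⟩
  have h1 : (blockGraph F pt).Reachable (pt (b, v)) (pt (b, v')) := (hF v v').map φ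
  exact ⟨fun h2 => h2.trans h1, fun h2 => h2.trans h1.symm⟩

/-- The first block of a chain is entered through `e`, and `f` is the current flag in it. -/
theorem exists_flagChain_of_path {p p' : P}
    (q : (blockGraph F pt).Walk p p') (hq : q.IsPath) (e f : B × V) (hef : e ≠ f)
    (hb : e.1 = f.1) (hf : pt f = p) (he : pt e ∉ q.support) :
    ∃ m ≤ q.length + 1, FlagChain pt e p' m := by
  induction q generalizing e f with
  | nil => exact ⟨1, by simp, hf ▸ .single hb hef⟩
  | cons hadj q ih =>
    obtain ⟨hq1, hq2⟩ := (Walk.cons_isPath_iff _ _).1 hq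
    obtain ⟨hne, b, v, v', hv, h1, h2⟩ := id hadj
    simp only [Walk.support_cons, List.mem_cons, not_or] at he
    by_cases hbb : e.1 = b
    · subst hbb
      obtain ⟨m, hm, hc⟩ := ih hq1 e (e.1, v')
        (fun hh => he.2 (by rw [hh, h2]; exact q.start_mem_support)) rfl h2 he.2
      exact ⟨m, hm.trans (by simp), hc⟩
    · obtain ⟨m, hm, hc⟩ := ih hq1 (b, v) (b, v') (by simpa using hv.ne) rfl h2 (by rwa [h1])
      refine ⟨m + 1, by simpa using hm, .cons hb hef (hf.trans h1.symm) ?_ hc⟩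
      intro hh
      exact hbb (by rw [hb, hh])

/-- A path back to the entry point of the first block either leaves that block, which yields a
closed chain, or stays inside it and is the image of a walk in `F`. -/
theorem exists_flagChain_or_lift (hg : GirthGE pt g) (h : 2 < g) {p p' : P}
    (q : (blockGraph F pt).Walk p p') (hq : q.IsPath) (e f : B × V) (hef : e ≠ f)
    (hb : e.1 = f.1) (hf : pt f = p) (he : pt e = p') :
    (∃ m ≤ q.length + 1, FlagChain pt e p' m) ∨
      ∃ r : F.Walk f.2 e.2, r.length = q.length ∧
        r.support.map (fun v => pt (e.1, v)) = q.support := by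
  induction q generalizing e f with
  | nil => exact Or.inl ⟨1, by simp, hf ▸ .single hb hef⟩
  | @cons p p₁ p' hadj q ih =>
    obtain ⟨hq1, hq2⟩ := (Walk.cons_isPath_iff _ _).1 hq
    obtain ⟨hne, b, v, v', hv, h1, h2⟩ := id hadj
    by_cases hbb : e.1 = b
    · subst hbb
      obtain ⟨b, w⟩ := e
      obtain ⟨b', z⟩ := f
      obtain rfl : b = b' := hb
      obtain rfl := hg.injective (by omega) b (h1.trans hf.symm)
      by_cases hp1 : p₁ = p'
      · subst hp1
        obtain rfl := hg.injective (by omega) b (he.trans h2.symm)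
        right
        have : q = Walk.nil := (Walk.isPath_iff_nil.1 hq1).eq_nil
        subst this
        exact ⟨Walk.cons hv Walk.nil, by simp, by simp [hf, h2]⟩
      · obtain ⟨m, hm, hc⟩ | ⟨r, hr, hs⟩ := ih hq1 (b, w) (b, v')
          (fun hh => hp1 (by rw [← h2, ← he, hh])) rfl h2 he
        · exact Or.inl ⟨m, hm.trans (by simp), hc⟩
        · exact Or.inr ⟨Walk.cons hv r, by simpa using hr, by simp [hf, hs]⟩
    · left
      obtain ⟨m, hm, hc⟩ := exists_flagChain_of_path q hq1 (b, v) (b, v')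
        (by simpa using hv.ne) rfl h2 (by rwa [h1])
      refine ⟨m + 1, by simpa using hm, .cons hb hef (hf.trans h1.symm) ?_ hc⟩
      intro hh
      exact hbb (by rw [hb, hh])

theorem le_circumference [Fintype V] {l : ℕ} (hl : HasCycleOfLength F l) :
    l ≤ circumference F := by
  classical
  refine le_csSup ⟨F.edgeFinset.card, ?_⟩ hl
  rintro _ ⟨u, p, hp, rfl⟩
  exact hp.isTrail.length_le_card_edgeFinset

theorem GirthGE.not_hasCycleOfLength [Fintype V] (hg : GirthGE pt g) (h : 2 < g) {l : ℕ}
    (hl : circumference F < l) (hlg : l < g) : ¬ HasCycleOfLength (blockGraph F pt) l := by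
  rintro ⟨u, p, hp, rfl⟩
  have hp3 := hp.three_le_length
  cases p with
  | nil => simp at hp3
  | cons hadj q =>
    obtain ⟨hq, -⟩ := (Walk.cons_isCycle_iff _ _).1 hp
    obtain ⟨hne, b, v, v', hv, h1, h2⟩ := id hadj
    obtain ⟨m, hm, hc⟩ | ⟨r, hr, hs⟩ := exists_flagChain_or_lift hg h q hq (b, v) (b, v')
      (by simpa using hv.ne) rfl h2 h1
    · exact hg _ _ _ hc (by simp at hlg; omega) h1
    · refine absurd (le_circumference (F := F) ⟨v, Walk.cons hv r, ?_, rfl⟩) ?_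
      · have hrp : r.IsPath := by
          rw [Walk.isPath_def]
          refine List.Nodup.of_map (fun v => pt (b, v)) ?_
          rw [hs]
          exact hq.support_nodup
        refine (Walk.cons_isCycle_iff _ _).2 ⟨hrp, fun hmem => ?_⟩
        simp only [Walk.length_cons] at hp3
        cases r with
        | nil => exact hv.ne rfl
        -- A path can use the removed edge only as its first edge; it then ends there, and the cycle
        -- would have length 2.
        | cons hadj' r' =>
          obtain ⟨hr1, hr2⟩ := (Walk.cons_isPath_iff _ _).1 hrp
          rw [Walk.edges_cons, List.mem_cons] at hmem
          obtain hmem | hmem := hmem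
          · rw [Sym2.eq_swap, Sym2.congr_right] at hmem
            subst hmem
            obtain rfl := (Walk.isPath_iff_nil.1 hr1).eq_nil
            simp at hr
            omega
          · exact hr2 (Walk.snd_mem_support_of_mem_edges _ hmem)
      · simp only [Walk.length_cons] at hl ⊢
        simp only [hr]
        omega

end

/-! ### Cyclic covers and non-bridge flags -/

section

variable {pt : B × V → P} {g : ℕ}

/-- The cyclic cover of `pt` with `q` sheets in which only the flag `e₀` changes sheets. -/
noncomputable def cyclicCover (pt : B × V → P) (e₀ : B × V) (q : ℕ) :
    (B × ZMod q) × V → P × ZMod q :=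
  open Classical in
  fun e => (pt (e.1.1, e.2), e.1.2 + if (e.1.1, e.2) = e₀ then 1 else 0)

theorem FlagChain.of_cyclicCover {e₀ : B × V} {q : ℕ} {e : (B × ZMod q) × V} {p : P × ZMod q}
    {m : ℕ} (h : FlagChain (cyclicCover pt e₀ q) e p m) :
    FlagChain pt (e.1.1, e.2) p.1 m := by
  have hblock : ∀ {e e' : (B × ZMod q) × V}, e.1 = e'.1 → e ≠ e' →
      (e.1.1, e.2) ≠ (e'.1.1, e'.2) := fun hb hne he => hne (Prod.ext hb (Prod.ext_iff.1 he).2)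
  induction h with
  | single hb hne => exact .single (congrArg Prod.fst hb :) (hblock hb hne)
  | cons hb hne hp hf _ ih =>
    refine .cons (congrArg Prod.fst hb :) (hblock hb hne) (congrArg Prod.fst hp :) (fun he => ?_) ih
    -- Flags over one point with the same projection undergo the same shift, so they lie on the same
    -- sheet.
    have h2 := congrArg Prod.snd hp
    simp only [cyclicCover] at h2
    rw [he] at h2
    replace h2 := add_right_cancel h2
    obtain ⟨h3, h4⟩ := Prod.ext_iff.1 he
    exact hf (Prod.ext (Prod.ext h3 h2) h4)

theorem GirthGE.cyclicCover (hg : GirthGE pt g) (e₀ : B × V) (q : ℕ) :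
    GirthGE (cyclicCover pt e₀ q) g :=
  fun _ _ m h hm he => hg _ _ m h.of_cyclicCover hm (congrArg Prod.fst he)

/-- The fibers of a cyclic cover are those of the base. -/
noncomputable def cyclicCoverFiberEquiv (pt : B × V → P) (e₀ : B × V) (q : ℕ) (p : P)
    (z : ZMod q) : {e // pt e = p} ≃ {e // cyclicCover pt e₀ q e = (p, z)} := by
  classical
  refine ⟨fun e => ⟨((e.1.1, z - if e.1 = e₀ then 1 else 0), e.1.2), ?_⟩,
    fun e => ⟨(e.1.1.1, e.1.2), congrArg Prod.fst e.2⟩, fun _ => rfl, fun e => ?_⟩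
  · exact Prod.ext e.2 (sub_add_cancel _ _)
  · apply Subtype.ext
    refine Prod.ext (Prod.ext rfl ?_) rfl
    have := congrArg Prod.snd e.2
    simp only [cyclicCover] at this
    simp only [← this, add_sub_cancel_right]

/-- Without `e₀` each sheet is linked as the base is; the block of `e₀` has another flag, and these
two join sheets `z` and `z + 1`. -/
theorem LinkedAvoiding.cyclicCover [Nontrivial V] {e₀ : B × V} (hl : LinkedAvoiding pt {e₀})
    (q : ℕ) [NeZero q] : LinkedAvoiding (cyclicCover pt e₀ q) ∅ := by
  intro f hf
  have hsheet : ∀ z p p', f (p, z) ↔ f (p', z) := by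
    intro z
    refine hl (fun p => f (p, z)) fun e e' he he' hb => ?_
    have := hf ((e.1, z), e.2) ((e'.1, z), e'.2) id id (by rw [hb])
    simp only [Set.mem_singleton_iff] at he he'
    simpa [ConstantLink.cyclicCover, he, he'] using this
  obtain ⟨b₀, v₀⟩ := e₀
  obtain ⟨v, hv⟩ := exists_ne v₀
  have hstep : ∀ z, f (pt (b₀, v₀), z + 1) ↔ f (pt (b₀, v₀), z) := by
    intro z
    have := hf ((b₀, z), v₀) ((b₀, z), v) id id rfl
    simp only [ConstantLink.cyclicCover, if_true, Prod.mk.injEq, hv, and_false, if_false,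
      add_zero] at this
    exact this.trans (hsheet _ _ _)
  have hall : ∀ n : ℕ, f (pt (b₀, v₀), (n : ZMod q)) ↔ f (pt (b₀, v₀), 0) := by
    intro n
    induction n with
    | zero => simp
    | succ n ih => rw [Nat.cast_succ, hstep, ih]
  have hall' : ∀ z : ZMod q, f (pt (b₀, v₀), z) ↔ f (pt (b₀, v₀), 0) := by
    intro z
    rw [← ZMod.natCast_zmod_val z]
    exact hall _
  rintro ⟨p, z⟩ ⟨p', z'⟩
  rw [hsheet z p (pt (b₀, v₀)), hsheet z' p' (pt (b₀, v₀)), hall' z, hall' z']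

/-- The bipartite incidence graph of blocks and points. -/
def incidenceGraph (pt : B × V → P) : SimpleGraph (B ⊕ P) where
  Adj x y := ∃ e, (x = .inl e.1 ∧ y = .inr (pt e)) ∨ (y = .inl e.1 ∧ x = .inr (pt e))
  symm := ⟨fun _ _ ⟨e, h⟩ => ⟨e, h.symm⟩⟩
  loopless := ⟨by rintro x ⟨e, ⟨h1, h2⟩ | ⟨h1, h2⟩⟩ <;> simp [h1] at h2⟩

theorem incidenceGraph_adj (e : B × V) :
    (incidenceGraph pt).Adj (.inl e.1) (.inr (pt e)) := ⟨e, .inl ⟨rfl, rfl⟩⟩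

theorem LinkedAvoiding.incidenceGraph_connected [Nonempty V] [Nonempty P]
    (hl : LinkedAvoiding pt ∅) : (incidenceGraph pt).Connected := by
  have p₀ : P := Classical.arbitrary P
  have hP : ∀ p, (incidenceGraph pt).Reachable (.inr p₀) (.inr p) := by
    intro p
    refine (hl (fun p => (incidenceGraph pt).Reachable (.inr p₀) (.inr p)) ?_ p₀ p).1
      (Reachable.refl _)
    intro e e' _ _ hb
    have h1 := (incidenceGraph_adj (pt := pt) e).reachable
    have h2 := (incidenceGraph_adj (pt := pt) e').reachable
    rw [hb] at h1
    exact ⟨fun h => h.trans (h1.symm.trans h2), fun h => h.trans (h2.symm.trans h1)⟩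
  refine (connected_iff_exists_forall_reachable _).2 ⟨.inr p₀, ?_⟩
  rintro (b | p)
  · exact (hP _).trans (incidenceGraph_adj (b, Classical.arbitrary V)).symm.reachable
  · exact hP p

theorem linkedAvoiding_of_connected_deleteEdges {e₀ : B × V}
    (h : ((incidenceGraph pt).deleteEdges {s(.inl e₀.1, .inr (pt e₀))}).Connected) :
    LinkedAvoiding pt {e₀} := by
  intro f hf
  let f' : B ⊕ P → Prop := Sum.elim (fun b => ∃ v, (b, v) ≠ e₀ ∧ f (pt (b, v))) f
  have hf' : ∀ e, e ≠ e₀ → (f' (.inl e.1) ↔ f' (.inr (pt e))) := by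
    intro e he
    constructor
    · rintro ⟨v, hv, hfv⟩
      exact (hf (e.1, v) e hv he rfl).1 hfv
    · exact fun h => ⟨e.2, he, h⟩
  have hadj : ∀ x y, ((incidenceGraph pt).deleteEdges {s(.inl e₀.1, .inr (pt e₀))}).Adj x y →
      (f' x ↔ f' y) := by
    intro x y hxy
    obtain ⟨⟨e, ⟨rfl, rfl⟩ | ⟨rfl, rfl⟩⟩, hne⟩ := (deleteEdges_adj).1 hxy
    · exact hf' e (by rintro rfl; exact hne rfl)
    · exact (hf' e (by rintro rfl; exact hne Sym2.eq_swap)).symm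
  have hreach : ∀ x y, ((incidenceGraph pt).deleteEdges {s(.inl e₀.1, .inr (pt e₀))}).Walk x y →
      (f' x ↔ f' y) := by
    intro x y w
    induction w with
    | nil => rfl
    | cons ha _ ih => exact (hadj _ _ ha).trans ih
  intro p p'
  exact (h (.inr p) (.inr p')).elim fun w => hreach _ _ w

/-- If every flag were a bridge, the incidence graph would be a tree. But its edges are the flags,
at least `2|P|` and at least `2|B|` in number, so at least `|P| + |B|`. -/
theorem LinkedAvoiding.exists_singleton [Finite B] [Finite V] [Finite P] [Nontrivial V]
    [Nonempty P] {t : ℕ} (ht : 2 ≤ t) (hfib : ∀ p, Nonempty (Fin t ≃ {e // pt e = p}))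
    (hinj : ∀ b v v', pt (b, v) = pt (b, v') → v = v') (hl : LinkedAvoiding pt ∅) :
    ∃ e₀, LinkedAvoiding pt {e₀} := by
  have hconn := hl.incidenceGraph_connected
  have hE : Nat.card (incidenceGraph pt).edgeSet = Nat.card (B × V) := by
    symm
    refine Nat.card_congr (Equiv.ofBijective
      (fun e => ⟨s(.inl e.1, .inr (pt e)), incidenceGraph_adj e⟩) ⟨?_, ?_⟩)
    · rintro ⟨b, v⟩ ⟨b', v'⟩ he
      have := congrArg Subtype.val he
      simp only [Sym2.eq_iff, Sum.inl.injEq, Sum.inr.injEq, reduceCtorEq, and_self,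
        or_false] at this
      obtain ⟨rfl, h2⟩ := this
      rw [hinj b v v' h2]
    · rintro ⟨x, hx⟩
      induction x with
      | h x y =>
        change (incidenceGraph pt).Adj x y at hx
        obtain ⟨e, ⟨rfl, rfl⟩ | ⟨rfl, rfl⟩⟩ := hx
        · exact ⟨e, rfl⟩
        · exact ⟨e, Subtype.ext Sym2.eq_swap⟩
  have hP : Nat.card (B × V) = Nat.card P * t := by
    rw [← Nat.card_congr (Equiv.sigmaFiberEquiv pt),
      Nat.card_congr ((Equiv.sigmaCongrRight fun p => (hfib p).some.symm).trans
        (Equiv.sigmaEquivProd P (Fin t)))]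
    simp
  have hV : 2 ≤ Nat.card V := Finite.one_lt_card
  by_contra hno
  push Not at hno
  have hac : (incidenceGraph pt).IsAcyclic := by
    rw [isAcyclic_iff_forall_isBridge]
    intro x hx
    by_contra hbr
    induction x with
    | h x y =>
      change (incidenceGraph pt).Adj x y at hx
      obtain ⟨e, ⟨rfl, rfl⟩ | ⟨rfl, rfl⟩⟩ := hx
      · exact hno e (linkedAvoiding_of_connected_deleteEdges
          (hconn.connected_delete_edge_of_not_isBridge hbr))
      · rw [Sym2.eq_swap] at hbr
        exact hno e (linkedAvoiding_of_connected_deleteEdges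
          (hconn.connected_delete_edge_of_not_isBridge hbr))
  have hcard := (isTree_iff_connected_and_card.1 ⟨hconn, hac⟩).2
  rw [Nat.card_sum, hE] at hcard
  have h1 : Nat.card P * 2 ≤ Nat.card P * t := Nat.mul_le_mul_left _ ht
  have h2 : Nat.card B * 2 ≤ Nat.card B * Nat.card V := Nat.mul_le_mul_left _ hV
  rw [← Nat.card_prod] at h2
  omega

end

/-! ### Finite quotients of free products -/

open Monoid

/-- A group homomorphism `A →* Y` lets `A` act on a subset `X` of `Y` by left multiplication,
where the points whose `A`-orbit leaves `X` are kept fixed. -/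
@[reducible]
noncomputable def truncatedAction {A Y : Type*} [Group A] [Group Y] (ψ : A →* Y) (X : Set Y) :
    MulAction A X := by
  classical
  exact
  { smul := fun a x => if h : ∀ a', ψ a' * x ∈ X then ⟨ψ a * x, h a⟩ else x
    one_smul := fun x => by
      change dite _ _ _ = _
      split_ifs <;> simp
    mul_smul := fun a a' x => by
      change dite _ _ _ = dite _ _ _
      by_cases h : ∀ a', ψ a' * x ∈ X
      · have h1 : (if h : ∀ a', ψ a' * x ∈ X then (⟨ψ a' * x, h a'⟩ : X) else x) =
          ⟨ψ a' * x, h a'⟩ := dif_pos h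
        have h2 : ∀ c, ψ c * (⟨ψ a' * x, h a'⟩ : X) ∈ X := fun c => by
          rw [← mul_assoc, ← map_mul]
          exact h _
        rw [dif_pos h]
        apply Subtype.ext
        change _ = ((if h' : ∀ c, ψ c * (if h : ∀ a', ψ a' * x ∈ X then (⟨ψ a' * x, h a'⟩ : X)
          else x) ∈ X then (⟨ψ a * (if h : ∀ a', ψ a' * x ∈ X then (⟨ψ a' * x, h a'⟩ : X)
          else x), h' a⟩ : X) else _ : X) : Y)
        rw [dif_pos (by rw [h1]; exact h2)]
        simp only [h1, map_mul, mul_assoc]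
      · have h1 : (if h : ∀ a', ψ a' * x ∈ X then (⟨ψ a' * x, h a'⟩ : X) else x) = x := dif_neg h
        rw [dif_neg h]
        change x = (if h' : ∀ c, ψ c * (if h : ∀ a', ψ a' * x ∈ X then (⟨ψ a' * x, h a'⟩ : X)
          else x) ∈ X then (⟨ψ a * (if h : ∀ a', ψ a' * x ∈ X then (⟨ψ a' * x, h a'⟩ : X)
          else x), h' a⟩ : X) else (if h : ∀ a', ψ a' * x ∈ X then (⟨ψ a' * x, h a'⟩ : X)
          else x))
        rw [dif_neg (by rw [h1]; exact h), h1] }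

/-- A free product of finite groups has finite permutation representations that do not kill the
nontrivial products of a bounded number of letters. -/
theorem exists_perm_representation {ι : Type} [Finite ι] (M : ι → Type) [∀ i, Group (M i)]
    [∀ i, Finite (M i)] (N : ℕ) :
    ∃ (X : Type) (_ : Finite X) (φ : CoprodI M →* Equiv.Perm X),
      ∀ w : CoprodI.Word M, w.toList.length ≤ N → φ w.prod = 1 → w = .empty := by
  classical
  let pr : List (Σ i, M i) → CoprodI M := fun l => (l.map fun s => CoprodI.of s.2).prod
  let X : Set (CoprodI M) := pr '' {l | l.length ≤ N}
  have hX : X.Finite := (List.finite_length_le _ N).image pr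
  let ρ : ∀ i, M i →* Equiv.Perm X := fun i =>
    letI := truncatedAction (CoprodI.of : M i →* CoprodI M) X
    MulAction.toPermHom (M i) X
  have hρ : ∀ i a (x : X) (h : ∀ a', CoprodI.of (i := i) a' * (x : CoprodI M) ∈ X),
      ρ i a x = ⟨CoprodI.of a * x, h a⟩ := fun i a x h => dif_pos h
  -- Letters applied from the right carry `1` through the suffix products. Before each letter the
  -- whole orbit under its factor is still in `X`, so the truncation never acts.
  have key : ∀ (l : List (Σ i, M i)) (hl : l.length ≤ N),
      CoprodI.lift ρ (pr l) ⟨1, [], by simp, by simp [pr]⟩ = ⟨pr l, l, hl, rfl⟩ := by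
    intro l
    induction l with
    | nil => intro hl; simp [pr]
    | cons s l ih =>
      intro hl
      obtain ⟨i, a⟩ := s
      have hcons : ∀ a', pr (⟨i, a'⟩ :: l) = CoprodI.of a' * pr l := fun a' => by simp [pr]
      simp only [hcons, map_mul, Equiv.Perm.mul_apply, CoprodI.lift_of]
      rw [ih (by simp at hl; omega), hρ]
      intro a'
      exact ⟨⟨i, a'⟩ :: l, hl, hcons a'⟩
  refine ⟨X, hX, CoprodI.lift ρ, fun w hw h => ?_⟩
  have h1 := key w.toList hw
  change CoprodI.lift ρ w.prod _ = _ at h1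
  rw [h] at h1
  have h2 : w.prod = CoprodI.Word.empty.prod := by
    rw [CoprodI.Word.prod_empty]
    exact (congrArg Subtype.val h1).symm
  exact CoprodI.Word.equiv.symm.injective h2

/-- Points and blocks are the left cosets of the images of the two groups in a finite quotient of
their free product, and flags are the elements of that quotient. -/
theorem exists_flagMap_of_groups (M : Bool → Type) [∀ i, Group (M i)] [∀ i, Finite (M i)]
    (lab : V ≃ M true) {t : ℕ} (ht : Nat.card (M false) = t) (g : ℕ) :
    ∃ (B P : Type) (_ : Finite B) (_ : Finite P) (_ : Nonempty P) (pt : B × V → P),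
      (∀ p, Nonempty (Fin t ≃ {e // pt e = p})) ∧ GirthGE pt g ∧ LinkedAvoiding pt ∅ := by
  -- A closed chain of `m < g` blocks gives at most `2m` letters plus one to close up; single
  -- letters must survive for every `g`.
  obtain ⟨X, _, φ, hφ⟩ := exists_perm_representation M (2 * g + 2)
  let Γ := φ.range
  let ψ : CoprodI M →* Γ := φ.rangeRestrict
  have hψsurj : Function.Surjective ψ := φ.rangeRestrict_surjective
  have hψ : ∀ w : CoprodI.Word M, w.toList.length ≤ 2 * g + 2 → ψ w.prod = 1 → w = .empty :=
    fun w hw h => hφ w hw (congrArg Subtype.val h)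
  let ρ : ∀ i, M i →* Γ := fun i => ψ.comp CoprodI.of
  have hρ : ∀ i, Function.Injective (ρ i) := by
    intro i
    rw [injective_iff_map_eq_one]
    intro a ha
    by_contra hne
    have := hψ (CoprodI.Word.cons a .empty (by simp [CoprodI.Word.fstIdx]) hne)
      (by simp [CoprodI.Word.cons]) (by rw [CoprodI.Word.prod_cons, CoprodI.Word.prod_empty, mul_one]; exact ha)
    exact absurd (congrArg CoprodI.Word.toList this) (by simp [CoprodI.Word.cons])
  have hmk : ∀ i (γ : Γ) a, (QuotientGroup.mk (γ * ρ i a) : Γ ⧸ (ρ i).range) =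
      QuotientGroup.mk γ := fun i γ a => QuotientGroup.mk_mul_of_mem _ ⟨a, rfl⟩
  let B := Γ ⧸ (ρ true).range
  let P := Γ ⧸ (ρ false).range
  let θ : B × V → Γ := fun e => e.1.out * ρ true (lab e.2)
  have hθB : ∀ e, (QuotientGroup.mk (θ e) : B) = e.1 :=
    fun e => (hmk true _ _).trans (Quotient.out_eq' _)
  have hθinj : Function.Injective θ := by
    rintro ⟨b, v⟩ ⟨b', v'⟩ h
    obtain rfl : b = b' := (hθB (b, v)).symm.trans ((congrArg _ h).trans (hθB (b', v')))
    exact congrArg _ (lab.injective (hρ true (mul_left_cancel h)))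
  have hθmul : ∀ e e', e.1 = e'.1 → θ e' = θ e * ρ true ((lab e.2)⁻¹ * lab e'.2) := by
    rintro ⟨b, v⟩ ⟨b', v'⟩ rfl
    simp [θ, mul_assoc]
  have hθsurj : Function.Surjective θ := by
    intro γ
    obtain ⟨⟨_, a, rfl⟩, ha⟩ := QuotientGroup.mk_out_eq_mul (ρ true).range γ
    refine ⟨(QuotientGroup.mk γ, lab.symm a⁻¹), ?_⟩
    change (QuotientGroup.mk γ : B).out * _ = _
    rw [ha]
    simp
  let pt : B × V → P := fun e => QuotientGroup.mk (θ e)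
  have hpt : ∀ e e', pt e = pt e' → ∃ c, θ e' = θ e * ρ false c := by
    intro e e' h
    obtain ⟨c, hc⟩ := QuotientGroup.eq.1 h
    exact ⟨c, by rw [hc, mul_inv_cancel_left]⟩
  -- A move within a block is right multiplication by a nontrivial letter of `M true`, a change of
  -- block at a point by one of `M false`; the letters alternate, so the word is reduced.
  have hchain : ∀ e p m, FlagChain pt e p m → ∃ w : CoprodI.Word M, w.fstIdx = some true ∧
      w.toList.length ≤ 2 * m ∧ QuotientGroup.mk (θ e * ψ w.prod) = p := by
    intro e p m h
    have hlab : ∀ {e e' : B × V}, e.1 = e'.1 → e ≠ e' → (lab e.2)⁻¹ * lab e'.2 ≠ 1 := by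
      intro e e' hb hne h
      exact hne (Prod.ext hb (lab.injective (inv_mul_eq_one.1 h)))
    induction h with
    | @single e e' hb hne =>
      refine ⟨CoprodI.Word.cons _ .empty (by simp [CoprodI.Word.fstIdx]) (hlab hb hne),
        by rw [CoprodI.Word.fstIdx_cons], by simp [CoprodI.Word.cons], ?_⟩
      rw [CoprodI.Word.prod_cons, CoprodI.Word.prod_empty, mul_one]
      exact congrArg QuotientGroup.mk (hθmul e e' hb).symm
    | @cons e e' f p m hb hne hp hf _ ih =>
      obtain ⟨w, hw, hlen, hwp⟩ := ih
      obtain ⟨c, hc⟩ := hpt _ _ hp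
      have hc1 : c ≠ 1 := by
        rintro rfl
        exact hf (hθinj (by simpa using hc.symm))
      refine ⟨CoprodI.Word.cons _ (CoprodI.Word.cons c w (by simp [hw]) hc1)
        (by simp [CoprodI.Word.fstIdx_cons]) (hlab hb hne),
        by rw [CoprodI.Word.fstIdx_cons], by simp [CoprodI.Word.cons]; omega, ?_⟩
      rw [CoprodI.Word.prod_cons, CoprodI.Word.prod_cons, map_mul ψ, map_mul ψ, ← mul_assoc,
        ← mul_assoc, ← hwp, hc, hθmul e e' hb]
      rfl
  refine ⟨B, P, inferInstance, inferInstance, inferInstance, pt, fun p => ?_, ?_, ?_⟩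
  · let θ' := Equiv.ofBijective θ ⟨hθinj, hθsurj⟩
    have hp : (QuotientGroup.mk p.out : P) = p := Quotient.out_eq' _
    have hmem : ∀ c, pt (θ'.symm (p.out * ρ false c)) = p := by
      intro c
      change QuotientGroup.mk (θ' (θ'.symm _)) = _
      rw [Equiv.apply_symm_apply]
      exact (hmk false _ _).trans hp
    have e1 : M false ≃ {e // pt e = p} := by
      refine Equiv.ofBijective (fun c => ⟨θ'.symm (p.out * ρ false c), hmem c⟩) ⟨?_, ?_⟩
      · intro c c' h
        exact hρ _ (mul_left_cancel (θ'.symm.injective (congrArg Subtype.val h)))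
      · rintro ⟨e, he⟩
        obtain ⟨c, hc⟩ := QuotientGroup.eq.1 (hp.trans he.symm)
        refine ⟨c, Subtype.ext ?_⟩
        change θ'.symm _ = e
        rw [Equiv.symm_apply_eq, hc, mul_inv_cancel_left]
        rfl
    exact ⟨((Finite.equivFinOfCardEq ht).symm).trans e1⟩
  · intro e p m h hm he
    obtain ⟨w, hw, hlen, hwp⟩ := hchain e p m h
    rw [← he] at hwp
    obtain ⟨c, hc⟩ := QuotientGroup.eq.1 hwp.symm
    rw [inv_mul_cancel_left] at hc
    -- The chain closes up to a letter `c` of `M false`. Either way a nonempty reduced word dies in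
    -- the quotient: `w` itself or `c⁻¹w`.
    by_cases hc1 : c = 1
    · subst hc1
      have := hψ w (by omega) (by rw [← hc, map_one])
      subst this
      simp [CoprodI.Word.fstIdx, CoprodI.Word.empty] at hw
    · have := hψ (CoprodI.Word.cons c⁻¹ w (by simp [hw]) (by simpa using hc1))
        (by simp [CoprodI.Word.cons]; omega) (by
          rw [CoprodI.Word.prod_cons, map_mul, ← hc]
          change ρ false c⁻¹ * _ = 1
          simp)
      exact absurd (congrArg CoprodI.Word.toList this) (by simp [CoprodI.Word.cons])
  · intro f hf
    -- Right multiplication by `M false` fixes the point and by `M true` fixes the block; these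
    -- letters generate.
    have hmul : ∀ (y : CoprodI M) (γ : Γ), f (QuotientGroup.mk (γ * ψ y)) ↔
        f (QuotientGroup.mk γ) := by
      intro y
      induction y using CoprodI.induction_on with
      | one => simp
      | mul x y hx hy => intro γ; rw [map_mul, ← mul_assoc, hy, hx]
      | of i a =>
        intro γ
        cases i with
        | false => exact iff_of_eq (congrArg f (hmk false γ a))
        | true =>
          obtain ⟨e, rfl⟩ := hθsurj γ
          obtain ⟨e', he'⟩ := hθsurj (θ e * ψ (CoprodI.of a))
          rw [← he']
          refine (hf e e' id id ?_).symm
          rw [← hθB e, ← hθB e', he']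
          exact (hmk true _ a).symm
    intro p p'
    obtain ⟨γ, rfl⟩ := QuotientGroup.mk_surjective p
    obtain ⟨γ', rfl⟩ := QuotientGroup.mk_surjective p'
    obtain ⟨y, hy⟩ := hψsurj (γ⁻¹ * γ')
    rw [← hmul y γ, hy, mul_inv_cancel_left]

theorem exists_flagMap [Finite V] [Nonempty V] {t : ℕ} (ht : 0 < t) (g : ℕ) :
    ∃ (B P : Type) (_ : Finite B) (_ : Finite P) (_ : Nonempty P) (pt : B × V → P),
      (∀ p, Nonempty (Fin t ≃ {e // pt e = p})) ∧ GirthGE pt g ∧ LinkedAvoiding pt ∅ := by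
  have : ∀ i : Bool, NeZero (cond i (Nat.card V) t) := by
    rintro (_ | _)
    · exact ⟨ht.ne'⟩
    · exact ⟨Nat.card_pos.ne'⟩
  refine exists_flagMap_of_groups (fun i => Multiplicative (ZMod (cond i (Nat.card V) t)))
    ((Finite.equivFin V).trans (Finite.equivFinOfCardEq (Nat.card_zmod _)).symm)
    (Nat.card_zmod t) g

theorem HasConstantLink.of_iso {V' : Type*} {G : SimpleGraph V} {G' : SimpleGraph V'}
    {L : SimpleGraph W} (e : G ≃g G') (h : HasConstantLink G' L) : HasConstantLink G L := by
  intro v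
  obtain ⟨i⟩ := h (e v)
  refine ⟨RelIso.trans ⟨(e.mapNeighborSet v), ?_⟩ i⟩
  intro a b
  exact e.map_rel_iff

theorem HasCycleOfLength.map_iso {V' : Type*} {G : SimpleGraph V} {G' : SimpleGraph V'}
    (e : G ≃g G') {l : ℕ} (h : HasCycleOfLength G l) : HasCycleOfLength G' l := by
  obtain ⟨u, p, hp, rfl⟩ := h
  exact ⟨e u, p.map e.toHom, hp.map e.injective, by simp⟩

end ConstantLink

theorem theorem15 {V W : Type*} [Fintype V] (t k g c : ℕ) (ht : 2 ≤ t) (hk : 2 ≤ k)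
    (hg : max 4 (k + 1) ≤ g) (F : SimpleGraph V) (L : SimpleGraph W) (hF : F.Connected)
    (hcard : Fintype.card V = k) (hL : ConstantLink.HasConstantLink F L)
    (hc : ConstantLink.circumference F = c) :
    ∃ n : ℕ, 0 < n ∧ ∀ q : ℕ, 1 ≤ q → ∃ G : SimpleGraph (Fin (q * n)),
      G.Connected ∧ ConstantLink.HasConstantLink G (ConstantLink.copies t L) ∧
        ∀ l : ℕ, c < l → l < g → ¬ ConstantLink.HasCycleOfLength G l := by
  open ConstantLink in
  have h4 : 3 < g := (le_max_left 4 (k + 1)).trans hg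
  have : Nontrivial V := Fintype.one_lt_card_iff_nontrivial.1 (by omega)
  obtain ⟨B, P, _, _, _, pt, hfib, hgirth, hlink⟩ := exists_flagMap (V := V) (by omega : 0 < t) g
  obtain ⟨e₀, he₀⟩ := hlink.exists_singleton ht hfib
    (fun b v v' h => hgirth.injective (by omega) b h)
  refine ⟨Nat.card P, Nat.card_pos, fun q hq => ?_⟩
  have : NeZero q := ⟨by omega⟩
  have hgirth' := hgirth.cyclicCover e₀ q
  have hlink' := he₀.cyclicCover q
  have hfib' : ∀ p, Nonempty (Fin t ≃ {e // cyclicCover pt e₀ q e = p}) := fun p =>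
    ⟨(hfib p.1).some.trans (cyclicCoverFiberEquiv pt e₀ q p.1 p.2)⟩
  have σ : P × ZMod q ≃ Fin (q * Nat.card P) :=
    Finite.equivFinOfCardEq (by simp [mul_comm])
  let i := (SimpleGraph.Iso.map σ (blockGraph F (cyclicCover pt e₀ q))).symm
  refine ⟨_, i.connected_iff.2 (hlink'.blockGraph_connected hF hgirth' (by omega)),
    .of_iso i (hgirth'.hasConstantLink h4 hfib' hL), fun l hl hlg h => ?_⟩
  exact hgirth'.not_hasCycleOfLength (by omega) (hc ▸ hl) hlg (h.map_iso i)
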